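/- Let $\sigma, r, b, A > 0$ and consider the generalized Lorenz system in $\mathbb{R}^3$ $$\dot x = -\sigma x + \sigma y - A y z,\qquad \dot y = r x - y - x z,\qquad \dot z = -b z + x y .$$ Write $\dot u = f(u)$ for it, let $\varphi^t(u_0)$, $t \ge 0$, be the value at time $t$ of the solution starting at $u_0$, and let $D\varphi^t(u)$ be the fundamental matrix of the linearization $\dot v = Df(\varphi^t(u))\,v$ with $D\varphi^0(u) = I$. For a $3\times 3$ matrix $M$ with singular values $\sigma_1(M) \ge \sigma_2(M) \ge \sigma_3(M)$ (counted with multiplicity) and $d \in [0,3]$ put $\omega_d(M) = \sigma_1(M)\cdots\sigma_{\lfloor d\rfloor}(M)\,\sigma_{\lfloor d\rfloor+1}(M)^{d-\lfloor d\rfloor}$ (so $\omega_0(M) = 1$ and $\omega_3(M) = \sigma_1(M)\sigma_2(M)\sigma_3(M)$). A set $K$ is invariant if $\varphi^t(K) = K$ for all $t \ge 0$, and the Lyapunov dimension of a nonempty compact invariant set $K$ is $$\dim_{\rm L}(\{\varphi^t\}_{t\ge0}, K) = \liminf_{t\to+\infty}\ \sup_{u\in K}\ \max\{d\in[0,3]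 : \omega_d(D\varphi^t(u)) \ge 1\};$$ for an equilibrium $S$ one writes $\dim_{\rm L}(\{\varphi^t\}_{t\ge0}, S)$ for $\dim_{\rm L}(\{\varphi^t\}_{t\ge0}, \{S\})$. Assume that one of the following holds: (i) $\sigma = Ar$ and $b < 1$; (ii) $\sigma = Ar$, $b \ge 1$ and $\sigma > b$; (iii) $\sigma \ge Ar$ and $b = 1$; and assume in addition that $$\frac{2(\sigma+b+1)}{\sigma+1+\sqrt{(\sigma-1)^2+4\sigma r}} \le 1 .$$ Then the system generates a dynamical system $\{\varphi^t\}_{t\ge0}$ on $\mathbb{R}^3$ (for every initial point there is exactly one solution on $[0,+\infty)$), the Lyapunov dimension of the zero equilibrium $S_0 = (0,0,0)$ is $$\dim_{\rm L}(\{\varphi^t\}_{t\ge0}, S_0) = 3 - \frac{2(\sigma+b+1)}{\sigma+1+\sqrt{(\sigma-1)^2+4\sigma r}},$$ and for every compact invariant set $K$ with $S_0 \in K$ $$\dim_{\rm L}(\{\varphi^t\}_{t\ge0}, K) = \dim_{\rm L}(\{\varphi^t\}_{t\ge0}, S_0) = 3 - \frac{2(\sigma+b+1)}{\sigma+1+\sqrt{(\sigma-1)^2+4\sigma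 r}} .$$ -/

import Mathlib

open Set Filter

noncomputable section

namespace LyapunovDimension

/-- `γ` solves `γ' = v t γ` on `[0, ∞)` with `γ 0 = x₀` (one-sided derivative at `0`). -/
def IsForwardSolution {F : Type*} [NormedAddCommGroup F] [NormedSpace ℝ F]
    (v : ℝ → F → F) (x₀ : F) (γ : ℝ → F) : Prop :=
  γ 0 = x₀ ∧ IsIntegralCurveOn γ v (Ici 0)

/-- Every initial value problem for `u' = f u` has exactly one solution on `[0, ∞)`. -/
def GeneratesDynamicalSystem {F : Type*} [NormedAddCommGroup F] [NormedSpace ℝ F]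
    (f : F → F) : Prop :=
  ∀ u₀ : F, ∃ γ : ℝ → F, IsForwardSolution (fun _ => f) u₀ γ ∧
    ∀ γ' : ℝ → F, IsForwardSolution (fun _ => f) u₀ γ' → EqOn γ' γ (Ici 0)

open Classical in
/-- The solution on `[0, ∞)` of the initial value problem (only its values at `t ≥ 0` matter; the
constant `x₀` is a placeholder for the case that there is no solution). -/
def forwardSolution {F : Type*} [NormedAddCommGroup F] [NormedSpace ℝ F]
    (v : ℝ → F → F) (x₀ : F) : ℝ → F :=
  if h : ∃ γ : ℝ → F, IsForwardSolution v x₀ γ then h.choose else fun _ => x₀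

/-- The evolutionary operator `φ^t(u)` of `u' = f u`. -/
def evolution {F : Type*} [NormedAddCommGroup F] [NormedSpace ℝ F]
    (f : F → F) (t : ℝ) (u : F) : F :=
  forwardSolution (fun _ => f) u t

/-- The fundamental matrix `Dφ^t(u)` of the linearization `v' = Df(φ^t(u)) v` along the solution
through `u`, equal to the identity at `t = 0`. -/
def fundamentalMatrix {F : Type*} [NormedAddCommGroup F] [NormedSpace ℝ F]
    (f : F → F) (t : ℝ) (u : F) : F →L[ℝ] F :=
  forwardSolution (fun s (X : F →L[ℝ] F) => (fderiv ℝ f (evolution f s u)).comp X)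
    (ContinuousLinearMap.id ℝ F) t

/-- `K` is invariant: `φ^t(K) = K` for all `t ≥ 0`. -/
def IsInvariantSet {F : Type*} [NormedAddCommGroup F] [NormedSpace ℝ F]
    (f : F → F) (K : Set F) : Prop :=
  ∀ t : ℝ, 0 ≤ t → evolution f t '' K = K

/-- The singular value function `ω_d(T) = σ₁ ⋯ σ_⌊d⌋ · σ_{⌊d⌋+1}^{d - ⌊d⌋}` of order `d ∈ [0, n]`.
Mathlib's singular values are indexed from `0`, in decreasing order with multiplicity; for `d = n`
the last factor is `0 ^ 0 = 1`. -/
def singularValueFunction {n : ℕ} (d : ℝ)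
    (T : EuclideanSpace ℝ (Fin n) →L[ℝ] EuclideanSpace ℝ (Fin n)) : ℝ :=
  (∏ i ∈ Finset.range ⌊d⌋₊, T.toLinearMap.singularValues i) *
    T.toLinearMap.singularValues ⌊d⌋₊ ^ (d - (⌊d⌋₊ : ℝ))

/-- The local Lyapunov dimension `dim_L(φ^t, u) = max {d ∈ [0, n] : ω_d(Dφ^t(u)) ≥ 1}`. -/
def localLyapunovDim {n : ℕ} (f : EuclideanSpace ℝ (Fin n) → EuclideanSpace ℝ (Fin n))
    (t : ℝ) (u : EuclideanSpace ℝ (Fin n)) : ℝ :=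
  sSup {d : ℝ | d ∈ Icc (0 : ℝ) n ∧ 1 ≤ singularValueFunction d (fundamentalMatrix f t u)}

/-- The Lyapunov dimension `dim_L(φ^t, K) = sup_{u ∈ K} dim_L(φ^t, u)` of the map `φ^t`. -/
def finiteTimeLyapunovDim {n : ℕ} (f : EuclideanSpace ℝ (Fin n) → EuclideanSpace ℝ (Fin n))
    (t : ℝ) (K : Set (EuclideanSpace ℝ (Fin n))) : ℝ :=
  sSup (localLyapunovDim f t '' K)

/-- The Lyapunov dimension `dim_L({φ^t}_{t ≥ 0}, K) = liminf_{t → +∞} dim_L(φ^t, K)`. -/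
def lyapunovDim {n : ℕ} (f : EuclideanSpace ℝ (Fin n) → EuclideanSpace ℝ (Fin n))
    (K : Set (EuclideanSpace ℝ (Fin n))) : ℝ :=
  liminf (fun t : ℝ => finiteTimeLyapunovDim f t K) atTop

/-- The right-hand side of the generalized Lorenz system
`x' = -σ x + σ y - A y z`, `y' = r x - y - x z`, `z' = -b z + x y`. -/
def generalizedLorenz (σ r b A : ℝ) (u : EuclideanSpace ℝ (Fin 3)) : EuclideanSpace ℝ (Fin 3) :=
  !₂[-σ * u 0 + σ * u 1 - A * u 1 * u 2, r * u 0 - u 1 - u 0 * u 2, -b * u 2 + u 0 * u 1]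

end LyapunovDimension

end

/-! Write τ = σ + b + 1, L = (σ + 1 + √D)/2 and D = (σ - 1)² + 4σr. The divergence of the system is
the constant -τ, so by Liouville every Dφ^t(u) has determinant exp(-τt). For d in [2, 3) one has ω_d
= |det| · σ₃^(d - 3), so near the top the dimension depends only on the decay of the smallest
singular value σ₃. If σ₃ ≥ c·exp(-Lt) uniformly on K and some point of K has σ₃ ≤ exp(-Lt), then the
dimension converges to 3 - τ/L. The assumption τ ≤ L places this value in [2, 3). At the origin the
rate L is attained because -L is an eigenvalue of Df(0).

The uniform lower bound is a Lyapunov function argument. In the metric (r/σ)v₀² + v₁² + v₂² the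
symmetrized linearization at (x, y, z) is bounded below by -(σ + 1 + √(D + w))/2, where w depends on
y and z only. Concavity gives √(D + w) ≤ √D + w/(2√D), and w is at most -(σ/r) times the time
derivative of a polynomial V (`compensator`). A total derivative integrates to a difference of
values of V, which stays bounded because trajectories in K remain in the compact set K; it affects
only the constant c. -/

noncomputable section

namespace LyapunovDimension

/-! ### Global existence and uniqueness for ODEs on [0, ∞). -/

section ODE

variable {F : Type*} [NormedAddCommGroup F] [NormedSpace ℝ F]

/-- Scaled truncation: a bounded Lipschitz map that is the identity on a given ball and shrinks
every vector towards the origin. -/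
theorem exists_lipschitz_truncation [FiniteDimensional ℝ F] (R : ℝ) :
    ∃ (c : F → ℝ) (K : NNReal) (B : ℝ), (∀ x, c x ∈ Icc (0 : ℝ) 1) ∧
      LipschitzWith K (fun x => c x • x) ∧ (∀ x, ‖c x • x‖ ≤ B) ∧ ∀ x, ‖x‖ ≤ R → c x = 1 := by
  obtain ⟨c, hc⟩ : ∃ c : F → ℝ, ContDiff ℝ 1 c ∧ HasCompactSupport c ∧ (∀ x, c x ∈ Icc (0 : ℝ) 1) ∧
      ∀ x, ‖x‖ ≤ R → c x = 1 := by
    let e := toEuclidean (E := F)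
    obtain ⟨R', hR'⟩ := (ProperSpace.isCompact_closedBall (0 : F) R).image
      e.continuous |>.isBounded.exists_norm_le
    let η : ContDiffBump (0 : EuclideanSpace ℝ (Fin (Module.finrank ℝ F))) :=
      ⟨max R' 1, max R' 1 + 1, by positivity, by linarith⟩
    refine ⟨fun x => η (e x), η.contDiff.comp e.contDiff,
      η.hasCompactSupport.comp_homeomorph e.toHomeomorph, fun x => ⟨η.nonneg, η.le_one⟩,
      fun x hx => η.one_of_mem_closedBall ?_⟩
    have := hR' (e x) ⟨x, by simpa using hx, rfl⟩
    simpa [η] using Or.inl this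
  obtain ⟨hc1, hc2, hc3, hc4⟩ := hc
  have hsupp : HasCompactSupport (fun x => c x • x) := hc2.smul_right
  have hcd : ContDiff ℝ 1 (fun x => c x • x) := hc1.smul contDiff_id
  obtain ⟨K, hK⟩ := ContDiff.lipschitzWith_of_hasCompactSupport hsupp hcd one_ne_zero
  obtain ⟨B, hB⟩ := hsupp.exists_bound_of_continuous hcd.continuous
  exact ⟨c, K, B, hc3, hK, hB, hc4⟩

theorem exists_isIntegralCurveOn_Icc_of_lipschitzWith [CompleteSpace F] {v : ℝ → F → F} {T : ℝ}
    (hT : 0 ≤ T) (x₀ : F) (hcont : ∀ x, ContinuousOn (v · x) (Icc 0 T)) {K : NNReal}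
    (hlip : ∀ t ∈ Icc 0 T, LipschitzWith K (v t)) {L : ℝ} (hL : ∀ t ∈ Icc 0 T, ∀ x, ‖v t x‖ ≤ L) :
    ∃ γ : ℝ → F, γ 0 = x₀ ∧ IsIntegralCurveOn γ v (Icc 0 T) := by
  have hL0 : 0 ≤ L := (norm_nonneg _).trans (hL 0 ⟨le_rfl, hT⟩ 0)
  have hPL : IsPicardLindelof v (⟨0, le_rfl, hT⟩ : Icc (0 : ℝ) T) x₀ (L.toNNReal * T.toNNReal) 0
      L.toNNReal K :=
    { lipschitzOnWith := fun t ht => (hlip t ht).lipschitzOnWith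
      continuousOn := fun x _ => hcont x
      norm_le := fun t ht x _ => (hL t ht x).trans (Real.le_coe_toNNReal L)
      mul_max_le := by simp [hT, hL0] }
  exact hPL.exists_eq_forall_mem_Icc_hasDerivWithinAt₀

theorem hasDerivWithinAt_Ici_of_isIntegralCurveOn {γ : ℝ → F} {v : ℝ → F → F} {T t : ℝ}
    (h : IsIntegralCurveOn γ v (Icc 0 T)) (ht : t ∈ Ico 0 T) :
    HasDerivWithinAt γ (v t (γ t)) (Ici t) t :=
  (h t (Ico_subset_Icc_self ht)).mono_of_mem_nhdsWithin (Icc_mem_nhdsGE_of_mem ht)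

/-- The vector field is Lipschitz on balls, locally uniformly in time. -/
def LipschitzOnBalls (v : ℝ → F → F) : Prop :=
  ∀ T R : ℝ, ∃ K : NNReal, ∀ t ∈ Icc 0 T, LipschitzOnWith K (v t) (Metric.closedBall 0 R)

theorem LipschitzOnBalls.eqOn_Icc {v : ℝ → F → F} (hv : LipschitzOnBalls v) {γ₁ γ₂ : ℝ → F}
    {T : ℝ} (h₁ : IsIntegralCurveOn γ₁ v (Icc 0 T)) (h₂ : IsIntegralCurveOn γ₂ v (Icc 0 T))
    (h0 : γ₁ 0 = γ₂ 0) : EqOn γ₁ γ₂ (Icc 0 T) := by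
  have c₁ : ContinuousOn γ₁ (Icc 0 T) := fun t ht => (h₁ t ht).continuousWithinAt
  have c₂ : ContinuousOn γ₂ (Icc 0 T) := fun t ht => (h₂ t ht).continuousWithinAt
  obtain ⟨R₁, hR₁⟩ := isCompact_Icc.exists_bound_of_continuousOn c₁
  obtain ⟨R₂, hR₂⟩ := isCompact_Icc.exists_bound_of_continuousOn c₂
  obtain ⟨K, hK⟩ := hv T (max R₁ R₂)
  refine ODE_solution_unique_of_mem_Icc_right (s := fun _ => Metric.closedBall 0 (max R₁ R₂))
    (fun t ht => hK t (Ico_subset_Icc_self ht)) c₁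
    (fun t ht => hasDerivWithinAt_Ici_of_isIntegralCurveOn h₁ ht)
    (fun t ht => ?_) c₂ (fun t ht => hasDerivWithinAt_Ici_of_isIntegralCurveOn h₂ ht)
    (fun t ht => ?_) h0
  · simpa using Or.inl (hR₁ t (Ico_subset_Icc_self ht))
  · simpa using Or.inr (hR₂ t (Ico_subset_Icc_self ht))

theorem LipschitzOnBalls.eqOn_Ici {v : ℝ → F → F} (hv : LipschitzOnBalls v) {γ₁ γ₂ : ℝ → F}
    {x₀ : F} (h₁ : IsForwardSolution v x₀ γ₁) (h₂ : IsForwardSolution v x₀ γ₂) :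
    EqOn γ₁ γ₂ (Ici 0) := fun _ ht =>
  hv.eqOn_Icc (h₁.2.mono Icc_subset_Ici_self) (h₂.2.mono Icc_subset_Ici_self)
    (h₁.1.trans h₂.1.symm) (right_mem_Icc.2 ht)

theorem LipschitzOnBalls.exists_isForwardSolution_of_Icc {v : ℝ → F → F} (hv : LipschitzOnBalls v)
    {x₀ : F} (h : ∀ T : ℝ, 0 ≤ T → ∃ γ : ℝ → F, γ 0 = x₀ ∧ IsIntegralCurveOn γ v (Icc 0 T)) :
    ∃ γ : ℝ → F, IsForwardSolution v x₀ γ := by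
  choose γ hγ0 hγ using fun n : ℕ => h n n.cast_nonneg
  have hagree : ∀ {m n : ℕ} {t : ℝ}, 0 ≤ t → t ≤ m → t ≤ n → γ m t = γ n t := by
    intro m n t h0 hm hn
    exact hv.eqOn_Icc ((hγ m).mono (Icc_subset_Icc_right hm)) ((hγ n).mono (Icc_subset_Icc_right hn))
      ((hγ0 m).trans (hγ0 n).symm) (right_mem_Icc.2 h0)
  -- Differentiability at t is read off the solution with index ⌈t⌉₊ + 1: if t is an integer, [0,
  -- ⌈t⌉₊] is not a neighbourhood of t within [0, ∞).
  refine ⟨fun t => γ ⌈t⌉₊ t, by simp [hγ0], fun t (ht : 0 ≤ t) => ?_⟩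
  have hlt : t < (⌈t⌉₊ + 1 : ℕ) := by push_cast; linarith [Nat.le_ceil t]
  have hmem : Icc (0 : ℝ) (⌈t⌉₊ + 1 : ℕ) ∈ nhdsWithin t (Ici 0) :=
    mem_of_superset (inter_mem_nhdsWithin (Ici 0) (Iio_mem_nhds hlt))
      fun s hs => ⟨hs.1, le_of_lt hs.2⟩
  have hd := (hγ (⌈t⌉₊ + 1) t ⟨ht, hlt.le⟩).mono_of_mem_nhdsWithin hmem
  have heq : γ ⌈t⌉₊ t = γ (⌈t⌉₊ + 1) t := hagree ht (Nat.le_ceil t) hlt.le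
  simp only [heq]
  refine hd.congr_of_eventuallyEq ?_ heq
  filter_upwards [hmem] with s hs
  exact hagree hs.1 (Nat.le_ceil s) hs.2

/-- Global existence from an a priori bound for the truncated equations. -/
theorem LipschitzOnBalls.exists_isForwardSolution [FiniteDimensional ℝ F] {v : ℝ → F → F}
    (hv : LipschitzOnBalls v) (hcont : ∀ x, ContinuousOn (v · x) (Ici 0)) {x₀ : F}
    (hbound : ∀ T : ℝ, 0 ≤ T → ∃ R : ℝ, ∀ (c : F → ℝ) (γ : ℝ → F), (∀ x, c x ∈ Icc (0 : ℝ) 1) →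
      γ 0 = x₀ → IsIntegralCurveOn γ (fun t x => v t (c x • x)) (Icc 0 T) →
      ∀ t ∈ Icc 0 T, ‖γ t‖ ≤ R) :
    ∃ γ : ℝ → F, IsForwardSolution v x₀ γ := by
  have := FiniteDimensional.complete ℝ F
  refine hv.exists_isForwardSolution_of_Icc fun T hT => ?_
  -- The bound R is uniform over all cutoffs c, so the cutoff can be chosen afterwards to equal 1 on
  -- the ball of radius R; the truncated solution then never sees the truncation.
  obtain ⟨R, hR⟩ := hbound T hT
  obtain ⟨c, K, B, hc, hK, hB, hc1⟩ := exists_lipschitz_truncation (F := F) R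
  obtain ⟨K', hK'⟩ := hv T B
  have hmaps : MapsTo (fun x => c x • x) univ (Metric.closedBall (0 : F) B) :=
    fun x _ => by simpa using hB x
  have hB0 : 0 ≤ B := (norm_nonneg _).trans (hB 0)
  obtain ⟨M, hM⟩ := isCompact_Icc.exists_bound_of_continuousOn
    ((hcont 0).mono (Icc_subset_Ici_self : Icc 0 T ⊆ Ici 0))
  have hlip : ∀ t ∈ Icc 0 T, LipschitzWith (K' * K) (fun x => v t (c x • x)) := fun t ht =>
    lipschitzOnWith_univ.1 ((hK' t ht).comp hK.lipschitzOnWith hmaps)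
  have hb : ∀ t ∈ Icc 0 T, ∀ x, ‖v t (c x • x)‖ ≤ M + K' * B := by
    intro t ht x
    have h1 := (hK' t ht).norm_sub_le (hmaps (mem_univ x)) (Metric.mem_closedBall_self hB0)
    have h2 : ‖v t (c x • x)‖ ≤ ‖v t 0‖ + ‖v t (c x • x) - v t 0‖ := by
      simpa using norm_add_le (v t 0) (v t (c x • x) - v t 0)
    rw [sub_zero] at h1
    have h3 : (K' : ℝ) * ‖c x • x‖ ≤ K' * B := by gcongr; exact hB x
    linarith [hM t ht]
  obtain ⟨γ, h0, hγ⟩ := exists_isIntegralCurveOn_Icc_of_lipschitzWith hT x₀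
    (v := fun t x => v t (c x • x)) (fun x => (hcont _).mono Icc_subset_Ici_self) hlip hb
  refine ⟨γ, h0, fun t ht => ?_⟩
  have := hγ t ht
  simpa [hc1 _ (hR c γ hc h0 hγ t ht)] using this

theorem le_mul_exp_of_deriv_le {g g' : ℝ → ℝ} {C T : ℝ}
    (hg : ∀ t ∈ Icc 0 T, HasDerivWithinAt g (g' t) (Icc 0 T) t)
    (hle : ∀ t ∈ Icc 0 T, g' t ≤ C * g t) :
    ∀ t ∈ Icc 0 T, g t ≤ g 0 * Real.exp (C * t) := by
  intro t ht
  have hd : ∀ s ∈ Icc 0 T, HasDerivWithinAt (fun s => g s * Real.exp (-C * s))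
      (g' s * Real.exp (-C * s) + g s * (Real.exp (-C * s) * -C)) (Icc 0 T) s := fun s hs =>
    (hg s hs).mul (by simpa using ((hasDerivAt_id s).const_mul (-C)).exp.hasDerivWithinAt)
  have hanti : AntitoneOn (fun s => g s * Real.exp (-C * s)) (Icc 0 T) := by
    refine antitoneOn_of_hasDerivWithinAt_nonpos (convex_Icc 0 T)
      (fun s hs => (hd s hs).continuousWithinAt)
      (fun s hs => (hd s (interior_subset hs)).mono interior_subset) fun s hs => ?_
    have := hle s (interior_subset hs)
    nlinarith [Real.exp_pos (-C * s)]
  have h := hanti ⟨le_rfl, ht.1.trans ht.2⟩ ht ht.1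
  simp only [mul_zero, Real.exp_zero, mul_one, neg_mul, Real.exp_neg] at h
  rwa [← div_eq_mul_inv, div_le_iff₀ (Real.exp_pos _)] at h

/-- Solvability of linear initial value problems for the operator equation `X' = A(t) ∘ X`. -/
theorem exists_isForwardSolution_linear [FiniteDimensional ℝ F] {A : ℝ → F →L[ℝ] F}
    (hA : ContinuousOn A (Ici 0)) (X₀ : F →L[ℝ] F) :
    ∃ X : ℝ → F →L[ℝ] F, IsForwardSolution (fun t X => (A t).comp X) X₀ X := by
  have hv : LipschitzOnBalls (fun t (X : F →L[ℝ] F) => (A t).comp X) := by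
    intro T R
    obtain ⟨M, hM⟩ := isCompact_Icc.exists_bound_of_continuousOn
      (hA.mono (Icc_subset_Ici_self : Icc 0 T ⊆ Ici 0))
    refine ⟨M.toNNReal, fun t ht => (LipschitzWith.of_dist_le_mul fun X Y => ?_).lipschitzOnWith⟩
    rw [dist_eq_norm, dist_eq_norm, ← ContinuousLinearMap.comp_sub]
    refine (ContinuousLinearMap.opNorm_comp_le _ _).trans ?_
    gcongr
    exact (hM t ht).trans (Real.le_coe_toNNReal M)
  refine hv.exists_isForwardSolution (fun X => hA.clm_comp continuousOn_const) fun T hT => ?_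
  obtain ⟨M, hM⟩ := isCompact_Icc.exists_bound_of_continuousOn
    (hA.mono (Icc_subset_Ici_self : Icc 0 T ⊆ Ici 0))
  refine ⟨gronwallBound ‖X₀‖ M 0 T, fun c X hc h0 hX t ht => ?_⟩
  have hM0 : 0 ≤ M := (norm_nonneg _).trans (hM t ht)
  refine (norm_le_gronwallBound_of_norm_deriv_right_le (δ := ‖X₀‖) (K := M) (ε := 0)
    (fun s hs => (hX s hs).continuousWithinAt)
    (fun s hs => hasDerivWithinAt_Ici_of_isIntegralCurveOn hX hs)
    (by rw [h0]) (fun s hs => ?_) t ht).trans ?_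
  · refine (ContinuousLinearMap.opNorm_comp_le _ _).trans ?_
    rw [add_zero]
    gcongr
    · exact hM s (Ico_subset_Icc_self hs)
    · rw [norm_smul, Real.norm_of_nonneg (hc _).1]
      exact mul_le_of_le_one_left (norm_nonneg _) (hc _).2
  · rw [sub_zero]
    exact gronwallBound_mono (norm_nonneg _) le_rfl hM0 ht.2

theorem isForwardSolution_forwardSolution {v : ℝ → F → F} {x₀ : F}
    (h : ∃ γ : ℝ → F, IsForwardSolution v x₀ γ) :
    IsForwardSolution v x₀ (forwardSolution v x₀) := by
  rw [forwardSolution, dif_pos h]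
  exact h.choose_spec

end ODE

/-! ### Extreme singular values and the determinant. -/

section SingularValues

variable {E : Type*} [NormedAddCommGroup E] [InnerProductSpace ℝ E] [FiniteDimensional ℝ E]

/-- A unit eigenvector of T*T is stretched by T by exactly the corresponding singular value. -/
theorem le_singularValues_of_forall_le_norm (T : E →ₗ[ℝ] E) {c : ℝ}
    (h : ∀ v, c * ‖v‖ ≤ ‖T v‖) {i : ℕ} (hi : i < Module.finrank ℝ E) :
    c ≤ T.singularValues i := by
  let b := T.isSymmetric_adjoint_comp_self.eigenvectorBasis rfl
  have hnorm : ‖b ⟨i, hi⟩‖ = 1 := b.orthonormal.1 _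
  have key : ‖T (b ⟨i, hi⟩)‖ ^ 2 = T.singularValues i ^ 2 := by
    rw [T.sq_singularValues_of_lt rfl hi, ← real_inner_self_eq_norm_sq,
      ← LinearMap.adjoint_inner_left, ← LinearMap.comp_apply, T.isSymmetric_adjoint_comp_self.apply_eigenvectorBasis rfl,
      real_inner_smul_left, real_inner_self_eq_norm_sq, hnorm]
    simp
  have h1 := h (b ⟨i, hi⟩)
  rw [hnorm, mul_one, (sq_eq_sq₀ (norm_nonneg _) (T.singularValues_nonneg i)).1 key] at h1
  exact h1

/-- In an eigenbasis of T*T, ‖Tv‖² is the sum of the squared coordinates weighted by the squared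
singular values. The index i is the last one or beyond, so none of these weights is below the i-th.
-/
theorem singularValues_mul_norm_le (T : E →ₗ[ℝ] E) {i : ℕ} (hi : Module.finrank ℝ E ≤ i + 1)
    (v : E) : T.singularValues i * ‖v‖ ≤ ‖T v‖ := by
  have hS := T.isSymmetric_adjoint_comp_self
  let b := hS.eigenvectorBasis rfl
  refine le_of_sq_le_sq ?_ (norm_nonneg _)
  have hT : ‖T v‖ ^ 2 = ∑ j : Fin (Module.finrank ℝ E), T.singularValues j ^ 2 * (b.repr v j) ^ 2 := by
    rw [← real_inner_self_eq_norm_sq, ← LinearMap.adjoint_inner_left, ← LinearMap.comp_apply,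
      ← b.repr.inner_map_map, PiLp.inner_apply]
    refine Finset.sum_congr rfl fun j _ => ?_
    rw [hS.eigenvectorBasis_apply_self_apply rfl, ← T.sq_singularValues_fin rfl]
    simp [b]
    ring
  rw [hT, mul_pow, ← b.repr.norm_map v, EuclideanSpace.norm_sq_eq, Finset.mul_sum]
  refine Finset.sum_le_sum fun j _ => ?_
  rw [Real.norm_eq_abs, sq_abs]
  gcongr
  · exact T.singularValues_nonneg i
  · exact T.singularValues_antitone (by have := j.2; omega)

theorem singularValueFunction_top {n : ℕ}
    (T : EuclideanSpace ℝ (Fin n) →L[ℝ] EuclideanSpace ℝ (Fin n)) :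
    singularValueFunction n T = |T.toLinearMap.det| := by
  rw [← LinearMap.normDet_eq_abs_det, LinearMap.normDet_eq_prod_singularValues]
  simp [singularValueFunction]

/-- On the last unit interval the singular value function is governed by the determinant and the
smallest singular value. -/
theorem singularValueFunction_eq_abs_det_mul_rpow {n : ℕ}
    (T : EuclideanSpace ℝ (Fin (n + 1)) →L[ℝ] EuclideanSpace ℝ (Fin (n + 1)))
    (hT : 0 < T.toLinearMap.singularValues n) {d : ℝ} (h1 : n ≤ d) (h2 : d < n + 1) :
    singularValueFunction d T =
      |T.toLinearMap.det| * T.toLinearMap.singularValues n ^ (d - (n + 1)) := by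
  have hfl : ⌊d⌋₊ = n := (Nat.floor_eq_iff ((Nat.cast_nonneg n).trans h1)).2 ⟨h1, h2⟩
  rw [← LinearMap.normDet_eq_abs_det, LinearMap.normDet_eq_prod_singularValues,
    finrank_euclideanSpace_fin, Finset.prod_range_succ, mul_assoc, singularValueFunction, hfl,
    show d - (n : ℝ) = 1 + (d - (n + 1)) by ring, Real.rpow_add hT, Real.rpow_one]

end SingularValues

/-! ### From determinant and smallest singular value to the Lyapunov dimension. -/

section Dimension

variable {n : ℕ} {f : EuclideanSpace ℝ (Fin (n + 1)) → EuclideanSpace ℝ (Fin (n + 1))}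

theorem localLyapunovDim_le_of_forall {n : ℕ}
    {f : EuclideanSpace ℝ (Fin n) → EuclideanSpace ℝ (Fin n)} {t D : ℝ}
    {u : EuclideanSpace ℝ (Fin n)}
    (h : ∀ d ∈ Icc (0 : ℝ) n, 1 ≤ singularValueFunction d (fundamentalMatrix f t u) → d ≤ D) :
    localLyapunovDim f t u ≤ D :=
  -- The set is nonempty because ω₀ = 1.
  csSup_le ⟨0, by simp [singularValueFunction]⟩ fun d hd => h d hd.1 hd.2

theorem le_localLyapunovDim {n : ℕ} {f : EuclideanSpace ℝ (Fin n) → EuclideanSpace ℝ (Fin n)}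
    {t d : ℝ} {u : EuclideanSpace ℝ (Fin n)} (hd : d ∈ Icc (0 : ℝ) n)
    (h : 1 ≤ singularValueFunction d (fundamentalMatrix f t u)) :
    d ≤ localLyapunovDim f t u :=
  le_csSup ⟨n, fun _ hx => hx.1.2⟩ ⟨hd, h⟩

theorem bddAbove_localLyapunovDim_image {n : ℕ}
    (f : EuclideanSpace ℝ (Fin n) → EuclideanSpace ℝ (Fin n)) (t : ℝ)
    (K : Set (EuclideanSpace ℝ (Fin n))) : BddAbove (localLyapunovDim f t '' K) := by
  refine ⟨n, ?_⟩
  rintro _ ⟨u, -, rfl⟩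
  exact localLyapunovDim_le_of_forall fun d hd _ => hd.2

/-- At d = n + 1 - τ/L the smallest singular value enters with the negative power -τ/L and
contributes at least exp(τt), which cancels the determinant. -/
theorem le_localLyapunovDim_of_norm_le {τ L t : ℝ} (hτ : 0 < τ) (hτL : τ ≤ L)
    {u v : EuclideanSpace ℝ (Fin (n + 1))} (hv : v ≠ 0)
    (hdet : |(fundamentalMatrix f t u).toLinearMap.det| = Real.exp (-τ * t))
    (hnorm : ‖fundamentalMatrix f t u v‖ ≤ Real.exp (-L * t) * ‖v‖) :
    n + 1 - τ / L ≤ localLyapunovDim f t u := by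
  have hL : 0 < L := hτ.trans_le hτL
  have h1 : τ / L ≤ 1 := (div_le_one hL).2 hτL
  have h0 : 0 < τ / L := div_pos hτ hL
  have hn : (0 : ℝ) ≤ n := n.cast_nonneg
  have hinj : Function.Injective (fundamentalMatrix f t u).toLinearMap := by
    refine (LinearMap.equivOfDetNeZero _ fun h => ?_).injective
    rw [h, abs_zero] at hdet
    exact (Real.exp_pos _).ne hdet
  have hpos := (LinearMap.injective_iff_forall_lt_finrank_singularValues_pos _).1 hinj n (by simp)
  have hle : (fundamentalMatrix f t u).toLinearMap.singularValues n ≤ Real.exp (-L * t) :=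
    le_of_mul_le_mul_right ((singularValues_mul_norm_le _ (by simp) v).trans hnorm)
      (norm_pos_iff.2 hv)
  refine le_localLyapunovDim ⟨by linarith, by push_cast; linarith⟩ ?_
  rw [singularValueFunction_eq_abs_det_mul_rpow _ hpos (by linarith) (by linarith), hdet,
    show (n : ℝ) + 1 - τ / L - (n + 1) = -(τ / L) by ring]
  have := Real.rpow_le_rpow_of_nonpos hpos hle (neg_nonpos.2 h0.le)
  rw [← Real.exp_mul, show -L * t * -(τ / L) = τ * t by field_simp] at this
  calc (1 : ℝ) = Real.exp (-τ * t) * Real.exp (τ * t) := by rw [← Real.exp_add]; simp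
    _ ≤ _ := by gcongr

/-- Any d above the bound exceeds n, since τ/L ≤ 1, so the formula for the last unit interval
applies. The constant c costs at most |log c| in the exponent, which εLt exceeds. -/
theorem localLyapunovDim_le_of_le_norm {τ L c t ε : ℝ} (hτ : 0 < τ) (hτL : τ ≤ L) (hc : 0 < c)
    (hε : 0 < ε) (ht : 0 < t) (htε : |Real.log c| < ε * L * t) {u : EuclideanSpace ℝ (Fin (n + 1))}
    (hdet : |(fundamentalMatrix f t u).toLinearMap.det| = Real.exp (-τ * t))
    (hnorm : ∀ v, c * Real.exp (-L * t) * ‖v‖ ≤ ‖fundamentalMatrix f t u v‖) :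
    localLyapunovDim f t u ≤ n + 1 - τ / L + ε := by
  have hL : 0 < L := hτ.trans_le hτL
  have h1 : τ / L ≤ 1 := (div_le_one hL).2 hτL
  refine localLyapunovDim_le_of_forall fun d hd hω => ?_
  by_contra! hlt
  push_cast at hd
  -- At the endpoint d = n + 1 the floor jumps; there ω_d is |det| = exp(-τt) < 1.
  rcases hd.2.eq_or_lt with rfl | hd2
  · have := singularValueFunction_top (fundamentalMatrix f t u)
    push_cast at this
    rw [this, hdet, Real.one_le_exp_iff] at hω
    nlinarith
  · have hge : c * Real.exp (-L * t) ≤ (fundamentalMatrix f t u).toLinearMap.singularValues n :=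
      le_singularValues_of_forall_le_norm _ hnorm (by simp)
    have hce : 0 < c * Real.exp (-L * t) := by positivity
    rw [singularValueFunction_eq_abs_det_mul_rpow _ (hce.trans_le hge) (by linarith) hd2,
      hdet] at hω
    have h2 := Real.rpow_le_rpow_of_nonpos hce hge (show d - (n + 1) ≤ 0 by linarith)
    have h3 : 1 ≤ Real.exp (-τ * t) * (c * Real.exp (-L * t)) ^ (d - (n + 1)) :=
      hω.trans (by gcongr)
    rw [Real.rpow_def_of_pos hce, Real.log_mul hc.ne' (Real.exp_pos _).ne', Real.log_exp,
      ← Real.exp_add, Real.one_le_exp_iff] at h3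
    set q := n + 1 - d with hq
    have hq0 : 0 < q := by linarith
    have hq1 : q < τ / L - ε := by linarith
    have hqL : q * (L * t) ≤ (τ / L - ε) * (L * t) := by gcongr
    have hqe : (τ / L - ε) * (L * t) = τ * t - ε * L * t := by field_simp
    have hlog : q * -Real.log c ≤ |Real.log c| :=
      (mul_le_mul_of_nonneg_left (neg_le_abs _) hq0.le).trans
        (mul_le_of_le_one_left (abs_nonneg _) (by linarith))
    have : d - (n + 1) = -q := by rw [hq]; ring
    rw [this] at h3
    nlinarith

/-- The Lyapunov dimension of a set along which volumes contract exactly like `exp (-τ t)` and the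
smallest singular value decays at most like `exp (-L t)`, with this rate attained at a point. -/
theorem lyapunovDim_eq_of_bounds {τ L c : ℝ} (hτ : 0 < τ) (hτL : τ ≤ L) (hc : 0 < c)
    {K : Set (EuclideanSpace ℝ (Fin (n + 1)))} {u₀ v₀ : EuclideanSpace ℝ (Fin (n + 1))}
    (hu₀ : u₀ ∈ K) (hv₀ : v₀ ≠ 0)
    (hdet : ∀ u ∈ K, ∀ t, 0 ≤ t →
      |(fundamentalMatrix f t u).toLinearMap.det| = Real.exp (-τ * t))
    (hnorm : ∀ u ∈ K, ∀ t, 0 ≤ t → ∀ v,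
      c * Real.exp (-L * t) * ‖v‖ ≤ ‖fundamentalMatrix f t u v‖)
    (hrate : ∀ t, 0 ≤ t → ‖fundamentalMatrix f t u₀ v₀‖ ≤ Real.exp (-L * t) * ‖v₀‖) :
    lyapunovDim f K = n + 1 - τ / L := by
  have hL : 0 < L := hτ.trans_le hτL
  refine Tendsto.liminf_eq (tendsto_order.2 ⟨fun a ha => ?_, fun a ha => ?_⟩)
  · filter_upwards [eventually_ge_atTop 0] with t ht
    exact ha.trans_le ((le_localLyapunovDim_of_norm_le hτ hτL hv₀ (hdet u₀ hu₀ t ht)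
      (hrate t ht)).trans (le_csSup (bddAbove_localLyapunovDim_image f t K) ⟨u₀, hu₀, rfl⟩))
  · obtain ⟨ε, hε, hεa⟩ : ∃ ε > 0, n + 1 - τ / L + ε < a :=
      ⟨(a - (n + 1 - τ / L)) / 2, by linarith, by linarith⟩
    filter_upwards [eventually_gt_atTop 0, eventually_gt_atTop (|Real.log c| / (ε * L))]
      with t ht ht'
    refine lt_of_le_of_lt (csSup_le ⟨_, u₀, hu₀, rfl⟩ ?_) hεa
    rintro _ ⟨u, hu, rfl⟩
    refine localLyapunovDim_le_of_le_norm hτ hτL hc hε ht ?_ (hdet u hu t ht.le) (hnorm u hu t ht.le)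
    rwa [div_lt_iff₀ (by positivity), mul_comm] at ht'

end Dimension

/-! ### The flow and its linearization. -/

section Flow

variable {F : Type*} [NormedAddCommGroup F] [NormedSpace ℝ F] {f : F → F}

theorem lipschitzOnBalls_of_contDiff [FiniteDimensional ℝ F] (hf : ContDiff ℝ 1 f) :
    LipschitzOnBalls (fun _ => f) := fun _ R =>
  (hf.contDiffOn.exists_lipschitzOnWith one_ne_zero (convex_closedBall 0 R)
    (ProperSpace.isCompact_closedBall 0 R)).imp fun _ hK _ _ => hK

theorem isForwardSolution_evolution (h : GeneratesDynamicalSystem f) (u : F) :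
    IsForwardSolution (fun _ => f) u (fun t => evolution f t u) :=
  isForwardSolution_forwardSolution ((h u).imp fun _ hγ => hγ.1)

theorem evolution_eq_of_zero (h : GeneratesDynamicalSystem f) {u : F} (hu : f u = 0) {t : ℝ}
    (ht : 0 ≤ t) : evolution f t u = u := by
  obtain ⟨γ, -, hγ⟩ := h u
  have hconst : IsForwardSolution (fun _ => f) u (fun _ => u) :=
    ⟨rfl, fun s _ => by simpa [hu] using hasDerivWithinAt_const s (Ici 0) u⟩
  exact (hγ _ (isForwardSolution_evolution h u) ht).trans (hγ _ hconst ht).symm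

theorem isInvariantSet_singleton_of_zero (h : GeneratesDynamicalSystem f) {u : F} (hu : f u = 0) :
    IsInvariantSet f {u} := fun t ht => by
  rw [image_singleton, evolution_eq_of_zero h hu ht]

theorem isForwardSolution_fundamentalMatrix [FiniteDimensional ℝ F] (hf : ContDiff ℝ 1 f)
    (h : GeneratesDynamicalSystem f) (u : F) :
    IsForwardSolution (fun t (X : F →L[ℝ] F) => (fderiv ℝ f (evolution f t u)).comp X)
      (ContinuousLinearMap.id ℝ F) (fun t => fundamentalMatrix f t u) := by
  refine isForwardSolution_forwardSolution (exists_isForwardSolution_linear ?_ _)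
  exact (hf.continuous_fderiv one_ne_zero).comp_continuousOn
    fun t ht => ((isForwardSolution_evolution h u).2 t ht).continuousWithinAt

theorem fundamentalMatrix_zero [FiniteDimensional ℝ F] (hf : ContDiff ℝ 1 f)
    (h : GeneratesDynamicalSystem f) (u : F) :
    fundamentalMatrix f 0 u = ContinuousLinearMap.id ℝ F :=
  (isForwardSolution_fundamentalMatrix hf h u).1

theorem hasDerivWithinAt_fundamentalMatrix_apply [FiniteDimensional ℝ F] (hf : ContDiff ℝ 1 f)
    (h : GeneratesDynamicalSystem f) (u v : F) {t : ℝ} (ht : 0 ≤ t) :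
    HasDerivWithinAt (fun t => fundamentalMatrix f t u v)
      (fderiv ℝ f (evolution f t u) (fundamentalMatrix f t u v)) (Ici 0) t := by
  simpa using ((isForwardSolution_fundamentalMatrix hf h u).2 t ht).clm_apply
    (hasDerivWithinAt_const t (Ici 0) v)

theorem fundamentalMatrix_apply_eigenvector [FiniteDimensional ℝ F] (hf : ContDiff ℝ 1 f)
    (h : GeneratesDynamicalSystem f) {u v : F} {μ : ℝ} (hu : f u = 0)
    (hv : fderiv ℝ f u v = μ • v) {t : ℝ} (ht : 0 ≤ t) :
    fundamentalMatrix f t u v = Real.exp (μ * t) • v := by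
  have hlip : LipschitzOnBalls (fun _ => fderiv ℝ f u) :=
    lipschitzOnBalls_of_contDiff (fderiv ℝ f u).contDiff
  refine hlip.eqOn_Ici (x₀ := v) (γ₁ := fun t => fundamentalMatrix f t u v)
    (γ₂ := fun t => Real.exp (μ * t) • v) ⟨by simp [fundamentalMatrix_zero hf h], fun s hs => ?_⟩
    ⟨by simp, fun s _ => ?_⟩ ht
  · simpa [evolution_eq_of_zero h hu hs] using
      hasDerivWithinAt_fundamentalMatrix_apply hf h u v hs
  · have := (((hasDerivAt_id s).const_mul μ).exp.smul_const v).hasDerivWithinAt (s := Ici 0)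
    simpa [hv, smul_smul] using this

end Flow

theorem hasDerivWithinAt_euclidean_apply {n : ℕ} {γ : ℝ → EuclideanSpace ℝ (Fin n)}
    {γ' : EuclideanSpace ℝ (Fin n)} {s : Set ℝ} {t : ℝ} (h : HasDerivWithinAt γ γ' s t)
    (i : Fin n) : HasDerivWithinAt (fun t => γ t i) (γ' i) s t :=
  (EuclideanSpace.proj (𝕜 := ℝ) i).hasFDerivAt.comp_hasDerivWithinAt t h

/-! ### The generalized Lorenz field: derivative and global existence. -/

section Lorenz

variable (σ r b A : ℝ)

theorem contDiff_generalizedLorenz : ContDiff ℝ 1 (generalizedLorenz σ r b A) := by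
  rw [contDiff_euclidean]
  intro i
  fin_cases i <;> simp [generalizedLorenz] <;> fun_prop

theorem fderiv_generalizedLorenz_apply (u v : EuclideanSpace ℝ (Fin 3)) :
    fderiv ℝ (generalizedLorenz σ r b A) u v =
      !₂[-σ * v 0 + (σ - A * u 2) * v 1 - A * u 1 * v 2, (r - u 2) * v 0 - v 1 - u 0 * v 2,
        u 1 * v 0 + u 0 * v 1 - b * v 2] := by
  have hf := ((contDiff_generalizedLorenz σ r b A).differentiable one_ne_zero u).hasFDerivAt
  have hline : HasDerivAt (fun s : ℝ => u + s • v) v 0 := by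
    simpa using ((hasDerivAt_id (0 : ℝ)).smul_const v).const_add u
  have hcomp : HasDerivAt (fun s : ℝ => generalizedLorenz σ r b A (u + s • v))
      (fderiv ℝ (generalizedLorenz σ r b A) u v) 0 := by
    have hf' : HasFDerivAt (generalizedLorenz σ r b A) (fderiv ℝ (generalizedLorenz σ r b A) u)
        (u + (0 : ℝ) • v) := by simpa using hf
    exact hf'.comp_hasDerivAt (0 : ℝ) hline
  have hc : ∀ i, HasDerivAt (fun s : ℝ => u i + s * v i) (v i) 0 := fun i => by
    simpa using ((hasDerivAt_id (0 : ℝ)).mul_const (v i)).const_add (u i)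
  have hi : ∀ i, HasDerivAt (fun s : ℝ => generalizedLorenz σ r b A (u + s • v) i)
      (fderiv ℝ (generalizedLorenz σ r b A) u v i) 0 := fun i => by
    simpa using hasDerivWithinAt_euclidean_apply hcomp.hasDerivWithinAt (s := univ) i
  ext i
  refine (hi i).unique ?_
  fin_cases i
  · have := (((hc 0).const_mul (-σ)).add ((hc 1).const_mul σ)).sub (((hc 1).const_mul A).mul (hc 2))
    exact this.congr_deriv (by simp; ring)
  · have := (((hc 0).const_mul r).sub (hc 1)).sub ((hc 0).mul (hc 2))
    exact this.congr_deriv (by simp; ring)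
  · have := ((hc 2).const_mul (-b)).add ((hc 0).mul (hc 1))
    exact this.congr_deriv (by simp; ring)

variable {σ r b A}

theorem generatesDynamicalSystem_generalizedLorenz (hσ : 0 < σ) (hr : 0 < r) (hb : 0 < b)
    (hA : 0 < A) : GeneratesDynamicalSystem (generalizedLorenz σ r b A) := by
  have hlip := lipschitzOnBalls_of_contDiff (contDiff_generalizedLorenz σ r b A)
  intro u₀
  suffices hex : ∃ γ, IsForwardSolution (fun _ => generalizedLorenz σ r b A) u₀ γ from
    hex.imp fun γ hγ => ⟨hγ, fun γ' hγ' => hlip.eqOn_Ici hγ' hγ⟩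
  refine hlip.exists_isForwardSolution (fun x => continuousOn_const) fun T hT => ?_
  -- The weight A + 1 makes the cubic terms cancel: -A·xyz - xyz + (A + 1)·xyz = 0. Truncation by
  -- scaling preserves this, so W grows at most at rate σ + r for every cutoff.
  let W : EuclideanSpace ℝ (Fin 3) → ℝ := fun u => u 0 ^ 2 + u 1 ^ 2 + (A + 1) * u 2 ^ 2
  have hW0 : 0 ≤ W u₀ := by positivity
  refine ⟨√(W u₀ * Real.exp ((σ + r) * T)), fun c γ hc h0 hγ t ht => ?_⟩
  have hd : ∀ i, ∀ s ∈ Icc 0 T, HasDerivWithinAt (fun s => γ s i)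
      (generalizedLorenz σ r b A (c (γ s) • γ s) i) (Icc 0 T) s :=
    fun i s hs => hasDerivWithinAt_euclidean_apply (hγ s hs) i
  have key := le_mul_exp_of_deriv_le (g := fun s => W (γ s)) (C := σ + r)
    (fun s hs => (((hd 0 s hs).pow 2).add ((hd 1 s hs).pow 2)).add
      (((hd 2 s hs).pow 2).const_mul (A + 1))) (fun s hs => ?_) t ht
  · refine Real.le_sqrt_of_sq_le ?_
    rw [EuclideanSpace.norm_sq_eq, Fin.sum_univ_three]
    simp only [Real.norm_eq_abs, sq_abs]
    have h1 : W u₀ * Real.exp ((σ + r) * t) ≤ W u₀ * Real.exp ((σ + r) * T) := by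
      gcongr; exact ht.2
    simp only [h0] at key
    have h2 : 0 ≤ A * γ t 2 ^ 2 := by positivity
    have h3 : W (γ t) = γ t 0 ^ 2 + γ t 1 ^ 2 + (A + 1) * γ t 2 ^ 2 := rfl
    nlinarith
  · obtain ⟨hc0, hc1⟩ := hc (γ s)
    simp only [W, generalizedLorenz, PiLp.smul_apply, smul_eq_mul]
    simp
    generalize c (γ s) = c at *
    generalize γ s 0 = x
    generalize γ s 1 = y
    generalize γ s 2 = z
    have e1 : 0 ≤ c * ((σ + r) * (x - y) ^ 2 + 2 * σ * x ^ 2 + 2 * y ^ 2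
        + 2 * b * (A + 1) * z ^ 2) := by positivity
    have e2 : 0 ≤ (1 - c) * ((σ + r) * (x ^ 2 + y ^ 2)) :=
      mul_nonneg (by linarith) (by positivity)
    have e3 : 0 ≤ (σ + r) * (A + 1) * z ^ 2 := by positivity
    nlinarith

end Lorenz

/-! ### Liouville's formula and the pointwise bound on the linearization. -/

section Lorenz

variable {σ r b A : ℝ}

theorem eq_exp_of_hasDerivWithinAt {g : ℝ → ℝ} {C : ℝ}
    (hg : ∀ t, 0 ≤ t → HasDerivWithinAt g (C * g t) (Ici 0) t) {t : ℝ} (ht : 0 ≤ t) :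
    g t = g 0 * Real.exp (C * t) := by
  have hg' : ∀ s ∈ Icc 0 t, HasDerivWithinAt g (C * g s) (Icc 0 t) s :=
    fun s hs => (hg s hs.1).mono Icc_subset_Ici_self
  have h1 := le_mul_exp_of_deriv_le hg' (fun s _ => le_rfl) t ⟨ht, le_rfl⟩
  have h2 := le_mul_exp_of_deriv_le (g := fun s => -g s) (C := C) (fun s hs => (hg' s hs).neg)
    (fun s _ => (mul_neg C (g s)).ge) t ⟨ht, le_rfl⟩
  rw [neg_mul] at h2
  exact le_antisymm h1 (neg_le_neg_iff.1 h2)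

theorem det_euclidean_three (T : EuclideanSpace ℝ (Fin 3) →ₗ[ℝ] EuclideanSpace ℝ (Fin 3)) :
    T.det = Matrix.det (.of fun i j : Fin 3 => T (EuclideanSpace.single j 1) i) := by
  rw [← LinearMap.det_toMatrix (EuclideanSpace.basisFun (Fin 3) ℝ).toBasis]
  congr 1

/-- Liouville's formula; the divergence of the generalized Lorenz system is constant. -/
theorem det_fundamentalMatrix_generalizedLorenz
    (h : GeneratesDynamicalSystem (generalizedLorenz σ r b A)) (u : EuclideanSpace ℝ (Fin 3))
    {t : ℝ} (ht : 0 ≤ t) :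
    (fundamentalMatrix (generalizedLorenz σ r b A) t u).toLinearMap.det =
      Real.exp (-(σ + b + 1) * t) := by
  set f := generalizedLorenz σ r b A
  have hf : ContDiff ℝ 1 f := contDiff_generalizedLorenz σ r b A
  let m : Fin 3 → Fin 3 → ℝ → ℝ := fun i j t => fundamentalMatrix f t u (EuclideanSpace.single j 1) i
  have hm : ∀ i j t, 0 ≤ t → HasDerivWithinAt (m i j) (fderiv ℝ f (evolution f t u)
      (fundamentalMatrix f t u (EuclideanSpace.single j 1)) i) (Ici 0) t := fun i j t ht =>
    hasDerivWithinAt_euclidean_apply (hasDerivWithinAt_fundamentalMatrix_apply hf h u _ ht) i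
  have hdet : ∀ t, (fundamentalMatrix f t u).toLinearMap.det =
      m 0 0 t * m 1 1 t * m 2 2 t - m 0 0 t * m 1 2 t * m 2 1 t - m 0 1 t * m 1 0 t * m 2 2 t
      + m 0 1 t * m 1 2 t * m 2 0 t + m 0 2 t * m 1 0 t * m 2 1 t - m 0 2 t * m 1 1 t * m 2 0 t :=
    fun t => by rw [det_euclidean_three, Matrix.det_fin_three]; rfl
  have key := eq_exp_of_hasDerivWithinAt (C := -(σ + b + 1))
    (g := fun t => (fundamentalMatrix f t u).toLinearMap.det) (fun s hs => ?_) ht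
  · simpa [fundamentalMatrix_zero hf h] using key
  · simp only [hdet]
    have h3 : ∀ i j i' j' i'' j'', HasDerivWithinAt (fun t => m i j t * m i' j' t * m i'' j'' t) _
        (Ici 0) s := fun i j i' j' i'' j'' =>
      ((hm i j s hs).mul (hm i' j' s hs)).mul (hm i'' j'' s hs)
    refine ((((((h3 0 0 1 1 2 2).sub (h3 0 0 1 2 2 1)).sub (h3 0 1 1 0 2 2)).add
      (h3 0 1 1 2 2 0)).add (h3 0 2 1 0 2 1)).sub (h3 0 2 1 1 2 0)).congr_deriv ?_
    simp only [f, fderiv_generalizedLorenz_apply]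
    simp [m]
    ring

/-- By AM-GM, (xs)² ≤ 4(Px²)(Qw) ≤ (Px² + Qw)². No division occurs, so P or Q may vanish. -/
theorem quadratic_form_nonneg {P Q w x s : ℝ} (hP : 0 ≤ P) (hQ : 0 ≤ Q) (hw : 0 ≤ w)
    (h : s ^ 2 ≤ 4 * (P * Q) * w) : 0 ≤ P * x ^ 2 + Q * w + x * s := by
  have h1 : (x * s) ^ 2 ≤ (P * x ^ 2 + Q * w) ^ 2 := by
    nlinarith [mul_le_mul_of_nonneg_left h (sq_nonneg x), sq_nonneg (P * x ^ 2 - Q * w)]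
  have h2 := (abs_le.1 (abs_le_of_sq_le_sq h1 (by positivity))).1
  linarith

/-- The symmetrized linearization in the metric `(r / σ) v₀² + v₁² + v₂²` is bounded below by its
smallest eigenvalue. -/
theorem linearization_form_lower_bound (hσ : 0 < σ) (hr : 0 < r) {α β : ℝ}
    (hcase : b = 1 ∨ β = 0 ∧ (b ≤ 1 ∨ b ≤ σ)) (v₀ v₁ v₂ : ℝ) :
    0 ≤ -(r * v₀ ^ 2) - v₁ ^ 2 - b * v₂ ^ 2 + v₀ * (α * v₁ + β * v₂)
      + (σ + 1 + √((σ - 1) ^ 2 + σ / r * (α ^ 2 + β ^ 2))) / 2 *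
        (r / σ * v₀ ^ 2 + v₁ ^ 2 + v₂ ^ 2) := by
  set S := √((σ - 1) ^ 2 + σ / r * (α ^ 2 + β ^ 2)) with hS
  have hS2 : S ^ 2 = (σ - 1) ^ 2 + σ / r * (α ^ 2 + β ^ 2) := Real.sq_sqrt (by positivity)
  have hS1 : |σ - 1| ≤ S := Real.abs_le_sqrt
    (by linarith [show 0 ≤ σ / r * (α ^ 2 + β ^ 2) by positivity])
  obtain ⟨hS3, hS4⟩ := abs_le.1 hS1
  set m := (σ + 1 + S) / 2 with hm
  have hm1 : 0 ≤ m - 1 := by linarith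
  have hmσ : 0 ≤ m - σ := by linarith
  -- m is the larger root of this quadratic equation, that is, the shift at which the discriminant
  -- condition of `quadratic_form_nonneg` becomes sharp.
  have hprod : 4 * (r / σ * (m - σ) * (m - 1)) = α ^ 2 + β ^ 2 := by
    have : 4 * ((m - σ) * (m - 1)) = σ / r * (α ^ 2 + β ^ 2) := by
      rw [hm]; linear_combination hS2
    rw [mul_assoc, ← mul_left_comm, this]
    field_simp
  have hP : 0 ≤ r / σ * (m - σ) := by positivity
  have hid : r / σ * (m - σ) = m * (r / σ) - r := by field_simp
  -- For b = 1, v₁ and v₂ have equal coefficients and Cauchy–Schwarz bounds (αv₁ + βv₂)². For β = 0,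
  -- v₂ decouples and needs only b ≤ m, which follows from m ≥ 1 and m ≥ σ.
  rcases hcase with rfl | ⟨rfl, hb⟩
  · have := quadratic_form_nonneg (x := v₀) (s := α * v₁ + β * v₂) (w := v₁ ^ 2 + v₂ ^ 2) hP hm1
      (by positivity) (by rw [hprod]; nlinarith [sq_nonneg (α * v₂ - β * v₁)])
    rw [hid] at this
    linarith
  · have := quadratic_form_nonneg (x := v₀) (s := α * v₁) (w := v₁ ^ 2) hP hm1
      (by positivity) (by rw [hprod]; nlinarith)
    rw [hid] at this
    have hmb : 0 ≤ (m - b) * v₂ ^ 2 := by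
      refine mul_nonneg ?_ (sq_nonneg _)
      rcases hb with hb | hb <;> linarith
    linarith

/-- The concave square root lies below its tangent at D. -/
theorem sqrt_add_le {D w : ℝ} (hD : 0 < D) (hw : 0 ≤ D + w) : √(D + w) ≤ √D + w / (2 * √D) := by
  have h1 : 0 < √D := Real.sqrt_pos.2 hD
  have h2 := Real.sq_sqrt hD.le
  have h3 := Real.sq_sqrt hw
  rw [← sub_le_iff_le_add', le_div_iff₀ (by positivity)]
  nlinarith [sq_nonneg (√(D + w) - √D)]

/-- The function whose derivative along trajectories compensates the growth of the nonlinear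
terms of the linearization. -/
def compensator (σ r b A : ℝ) (u : EuclideanSpace ℝ (Fin 3)) : ℝ :=
  2 * (1 + A * r / σ) / b * (u 1 ^ 2 + u 2 ^ 2 - 2 * r * u 2)

/-- The derivative of `compensator` along the generalized Lorenz system. -/
def compensatorDeriv (σ r b A : ℝ) (u : EuclideanSpace ℝ (Fin 3)) : ℝ :=
  4 * (1 + A * r / σ) * (r * u 2 - u 2 ^ 2 - u 1 ^ 2 / b)

theorem hasDerivWithinAt_compensator (hb : 0 < b) {γ : ℝ → EuclideanSpace ℝ (Fin 3)} {s : Set ℝ}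
    {t : ℝ} (hγ : HasDerivWithinAt γ (generalizedLorenz σ r b A (γ t)) s t) :
    HasDerivWithinAt (fun t => compensator σ r b A (γ t)) (compensatorDeriv σ r b A (γ t)) s t := by
  have h1 := hasDerivWithinAt_euclidean_apply hγ 1
  have h2 := hasDerivWithinAt_euclidean_apply hγ 2
  have := ((((h1.pow 2).add (h2.pow 2)).sub (h2.const_mul (2 * r))).const_mul
    (2 * (1 + A * r / σ) / b))
  refine this.congr_deriv ?_
  simp [generalizedLorenz, compensatorDeriv]
  field_simp
  ring

theorem linearization_lower_bound (hσ : 0 < σ) (hr : 0 < r) (hb : 0 < b) (hA : 0 < A)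
    (hparam : (σ = A * r ∧ b < 1) ∨ (σ = A * r ∧ 1 ≤ b ∧ b < σ) ∨ (A * r ≤ σ ∧ b = 1))
    (u v : EuclideanSpace ℝ (Fin 3)) :
    -(((σ + 1 + √((σ - 1) ^ 2 + 4 * σ * r)) / 2 -
        σ / (4 * r * √((σ - 1) ^ 2 + 4 * σ * r)) * compensatorDeriv σ r b A u) *
        (r / σ * v 0 ^ 2 + v 1 ^ 2 + v 2 ^ 2)) ≤
      r / σ * v 0 * fderiv ℝ (generalizedLorenz σ r b A) u v 0 +
        v 1 * fderiv ℝ (generalizedLorenz σ r b A) u v 1 +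
        v 2 * fderiv ℝ (generalizedLorenz σ r b A) u v 2 := by
  set a := A * r / σ with ha
  have ha0 : 0 < a := by positivity
  have ha1 : a ≤ 1 := (div_le_one hσ).2 (by rcases hparam with h | h | h <;> linarith [h.1])
  set D := (σ - 1) ^ 2 + 4 * σ * r with hD
  have hD0 : 0 < D := by positivity
  set α := 2 * r - (1 + a) * u 2 with hα
  set β := (1 - a) * u 1 with hβ
  have hcase : b = 1 ∨ β = 0 ∧ (b ≤ 1 ∨ b ≤ σ) := by
    have : σ = A * r → β = 0 := fun h => by rw [hβ, ha, ← h, div_self hσ.ne']; ring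
    rcases hparam with h | h | h
    · exact .inr ⟨this h.1, .inl h.2.le⟩
    · exact .inr ⟨this h.1, .inr h.2.2.le⟩
    · exact .inl h.2
  have hform := linearization_form_lower_bound (α := α) hσ hr hcase (v 0) (v 1) (v 2)
  -- The terms linear in z agree on both sides. What remains is (1 + a)² ≤ 4(1 + a) for z², true as
  -- a ≤ 1, and (1 - a)² ≤ 4(1 + a)/b for y², where b = 1 or the left side's contribution β²
  -- vanishes.
  have hN : α ^ 2 + β ^ 2 - 4 * r ^ 2 ≤ -compensatorDeriv σ r b A u := by
    have hz : (1 + a) * (a - 3) * u 2 ^ 2 ≤ 0 :=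
      mul_nonpos_of_nonpos_of_nonneg (by nlinarith) (sq_nonneg _)
    have hy : (1 - a) ^ 2 * u 1 ^ 2 ≤ 4 * (1 + a) * (u 1 ^ 2 / b) := by
      rcases hcase with h | h
      · rw [h, div_one]
        gcongr
        nlinarith
      · rw [← mul_pow, ← hβ, h.1, zero_pow two_ne_zero]
        positivity
    rw [compensatorDeriv, ← ha, hα, hβ]
    nlinarith
  have hsqrt : √((σ - 1) ^ 2 + σ / r * (α ^ 2 + β ^ 2)) / 2 ≤
      √D / 2 - σ / (4 * r * √D) * compensatorDeriv σ r b A u := by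
    have h2 : D + σ / r * (α ^ 2 + β ^ 2 - 4 * r ^ 2) =
        (σ - 1) ^ 2 + σ / r * (α ^ 2 + β ^ 2) := by rw [hD]; field_simp; ring
    have h1 := sqrt_add_le hD0 (w := σ / r * (α ^ 2 + β ^ 2 - 4 * r ^ 2))
      (by rw [h2]; positivity)
    rw [h2] at h1
    have hsD : 0 < √D := Real.sqrt_pos.2 hD0
    have h3 : σ / (4 * r * √D) * (α ^ 2 + β ^ 2 - 4 * r ^ 2) ≤
        σ / (4 * r * √D) * -compensatorDeriv σ r b A u := by gcongr
    have h4 : σ / r * (α ^ 2 + β ^ 2 - 4 * r ^ 2) / (2 * √D) =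
        2 * (σ / (4 * r * √D) * (α ^ 2 + β ^ 2 - 4 * r ^ 2)) := by field_simp; ring
    rw [h4] at h1
    linarith
  have hq : 0 ≤ r / σ * v 0 ^ 2 + v 1 ^ 2 + v 2 ^ 2 := by positivity
  have hmono := mul_le_mul_of_nonneg_right hsqrt hq
  have hJ : r / σ * v 0 * fderiv ℝ (generalizedLorenz σ r b A) u v 0 +
        v 1 * fderiv ℝ (generalizedLorenz σ r b A) u v 1 +
        v 2 * fderiv ℝ (generalizedLorenz σ r b A) u v 2 =
      -(r * v 0 ^ 2) - v 1 ^ 2 - b * v 2 ^ 2 + v 0 * (α * v 1 + β * v 2) := by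
    simp only [fderiv_generalizedLorenz_apply, hα, hβ, ha]
    simp
    field_simp
    ring
  rw [hJ]
  linarith

end Lorenz

/-! ### Uniform decay bound along trajectories, and the dimension formula. -/

section Lorenz

variable {σ r b A : ℝ}

/-- The squared norm in the metric adapted to the linearization at the origin. -/
def weightedForm (σ r : ℝ) (v : EuclideanSpace ℝ (Fin 3)) : ℝ :=
  r / σ * v 0 ^ 2 + v 1 ^ 2 + v 2 ^ 2

theorem hasDerivWithinAt_weightedForm (σ r : ℝ) {γ : ℝ → EuclideanSpace ℝ (Fin 3)}
    {γ' : EuclideanSpace ℝ (Fin 3)} {s : Set ℝ} {t : ℝ} (hγ : HasDerivWithinAt γ γ' s t) :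
    HasDerivWithinAt (fun t => weightedForm σ r (γ t))
      (2 * (r / σ * γ t 0 * γ' 0 + γ t 1 * γ' 1 + γ t 2 * γ' 2)) s t := by
  have h := hasDerivWithinAt_euclidean_apply hγ
  refine (((((h 0).pow 2).const_mul (r / σ)).add ((h 1).pow 2)).add ((h 2).pow 2)).congr_deriv ?_
  simp
  ring

/-- The factor exp(-2κV) absorbs the u-dependent part of the pointwise bound, so the product with
the weighted form has logarithmic derivative at least -2L where it is nonzero. The comparison lemma
is applied to its negative. -/
theorem weightedForm_fundamentalMatrix_lower_bound (hσ : 0 < σ) (hr : 0 < r) (hb : 0 < b) (hA : 0 < A)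
    (hparam : (σ = A * r ∧ b < 1) ∨ (σ = A * r ∧ 1 ≤ b ∧ b < σ) ∨ (A * r ≤ σ ∧ b = 1))
    (h : GeneratesDynamicalSystem (generalizedLorenz σ r b A))
    {L κ : ℝ} (hL : L = (σ + 1 + √((σ - 1) ^ 2 + 4 * σ * r)) / 2)
    (hκ : κ = σ / (4 * r * √((σ - 1) ^ 2 + 4 * σ * r)))
    (u v : EuclideanSpace ℝ (Fin 3)) {t : ℝ} (ht : 0 ≤ t) :
    weightedForm σ r v * Real.exp (-2 * κ * compensator σ r b A u) * Real.exp (-2 * L * t) ≤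
      weightedForm σ r (fundamentalMatrix (generalizedLorenz σ r b A) t u v) *
        Real.exp (-2 * κ * compensator σ r b A (evolution (generalizedLorenz σ r b A) t u)) := by
  have hf := contDiff_generalizedLorenz σ r b A
  have hbound := linearization_lower_bound hσ hr hb hA hparam
  rw [← hL, ← hκ] at hbound
  set f := generalizedLorenz σ r b A
  have hv : ∀ s ∈ Icc 0 t, HasDerivWithinAt (fun s => weightedForm σ r (fundamentalMatrix f s u v))
      _ (Icc 0 t) s := fun s hs => hasDerivWithinAt_weightedForm σ r
    ((hasDerivWithinAt_fundamentalMatrix_apply hf h u v hs.1).mono Icc_subset_Ici_self)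
  have hV : ∀ s ∈ Icc 0 t, HasDerivWithinAt (fun s => compensator σ r b A (evolution f s u))
      (compensatorDeriv σ r b A (evolution f s u)) (Icc 0 t) s := fun s hs =>
    (hasDerivWithinAt_compensator hb ((isForwardSolution_evolution h u).2 s hs.1)).mono
      Icc_subset_Ici_self
  have key := le_mul_exp_of_deriv_le (C := -2 * L)
    (fun s hs => ((hv s hs).fun_mul ((hV s hs).const_mul (-2 * κ)).exp).fun_neg)
    (fun s hs => ?_) t ⟨ht, le_rfl⟩
  · simp only [fundamentalMatrix_zero hf h, (isForwardSolution_evolution h u).1] at key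
    simp only [ContinuousLinearMap.id_apply, neg_mul, neg_le_neg_iff] at key ⊢
    exact key
  · have := mul_nonneg (Real.exp_pos (-2 * κ * compensator σ r b A (evolution f s u))).le
      (sub_nonneg.2 (hbound (evolution f s u) (fundamentalMatrix f s u v)))
    simp only [weightedForm]
    linear_combination 2 * this

theorem fundamentalMatrix_norm_lower_bound (hσ : 0 < σ) (hr : 0 < r) (hb : 0 < b) (hA : 0 < A)
    (hparam : (σ = A * r ∧ b < 1) ∨ (σ = A * r ∧ 1 ≤ b ∧ b < σ) ∨ (A * r ≤ σ ∧ b = 1))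
    (h : GeneratesDynamicalSystem (generalizedLorenz σ r b A))
    {K : Set (EuclideanSpace ℝ (Fin 3))} (hK : IsCompact K)
    (hinv : IsInvariantSet (generalizedLorenz σ r b A) K) :
    ∃ c > 0, ∀ u ∈ K, ∀ t, 0 ≤ t → ∀ v,
      c * Real.exp (-((σ + 1 + √((σ - 1) ^ 2 + 4 * σ * r)) / 2) * t) * ‖v‖ ≤
        ‖fundamentalMatrix (generalizedLorenz σ r b A) t u v‖ := by
  set L := (σ + 1 + √((σ - 1) ^ 2 + 4 * σ * r)) / 2 with hL
  set κ := σ / (4 * r * √((σ - 1) ^ 2 + 4 * σ * r)) with hκ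
  have hκ0 : 0 ≤ κ := by positivity
  have hcont : Continuous (compensator σ r b A) := by unfold compensator; fun_prop
  obtain ⟨B, hB⟩ := hK.exists_bound_of_continuousOn hcont.continuousOn
  have hp : 0 < r / σ := by positivity
  have hsq : ∀ v : EuclideanSpace ℝ (Fin 3), ‖v‖ ^ 2 = v 0 ^ 2 + v 1 ^ 2 + v 2 ^ 2 := fun v => by
    simp [EuclideanSpace.norm_sq_eq, Fin.sum_univ_three]
  have hqlow : ∀ v, min (r / σ) 1 * ‖v‖ ^ 2 ≤ weightedForm σ r v := fun v => by
    rw [hsq, mul_add, mul_add]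
    have h1 := mul_le_mul_of_nonneg_right (min_le_left (r / σ) 1) (sq_nonneg (v 0))
    have h2 := mul_le_mul_of_nonneg_right (min_le_right (r / σ) 1) (sq_nonneg (v 1))
    have h3 := mul_le_mul_of_nonneg_right (min_le_right (r / σ) 1) (sq_nonneg (v 2))
    rw [weightedForm]
    linarith
  have hqup : ∀ v, weightedForm σ r v ≤ (r / σ + 1) * ‖v‖ ^ 2 := fun v => by
    rw [hsq]
    have h1 : 0 ≤ v 0 ^ 2 + r / σ * (v 1 ^ 2 + v 2 ^ 2) := by positivity
    rw [weightedForm]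
    linarith
  have hm : 0 < min (r / σ) 1 := lt_min hp one_pos
  -- This is c²: the ratio compares the weighted and Euclidean norms, and the exponential is the
  -- worst change of exp(-2κV) when |V| ≤ B at both ends.
  have hc0 : 0 < min (r / σ) 1 / (r / σ + 1) * Real.exp (-4 * κ * B) := by positivity
  refine ⟨√(min (r / σ) 1 / (r / σ + 1) * Real.exp (-4 * κ * B)), Real.sqrt_pos.2 hc0,
    fun u hu t ht v => ?_⟩
  have hut : evolution (generalizedLorenz σ r b A) t u ∈ K := hinv t ht ▸ mem_image_of_mem _ hu
  have hkey := weightedForm_fundamentalMatrix_lower_bound hσ hr hb hA hparam h hL hκ u v ht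
  set w := fundamentalMatrix (generalizedLorenz σ r b A) t u v
  have hV₀ := (abs_le.1 (hB u hu)).2
  have hV₁ := (abs_le.1 (hB _ hut)).1
  have he₀ : Real.exp (-2 * κ * B) ≤ Real.exp (-2 * κ * compensator σ r b A u) :=
    Real.exp_le_exp.2 (by nlinarith)
  have he₁ : Real.exp (-2 * κ * compensator σ r b A
      (evolution (generalizedLorenz σ r b A) t u)) ≤ Real.exp (2 * κ * B) :=
    Real.exp_le_exp.2 (by nlinarith)
  have hle : min (r / σ) 1 * ‖v‖ ^ 2 * Real.exp (-2 * κ * B) * Real.exp (-2 * L * t) ≤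
      (r / σ + 1) * ‖w‖ ^ 2 * Real.exp (2 * κ * B) := by
    have hqv : 0 ≤ weightedForm σ r v := by rw [weightedForm]; positivity
    calc _ ≤ weightedForm σ r v * Real.exp (-2 * κ * compensator σ r b A u) * Real.exp (-2 * L * t) := by
          gcongr; exact hqlow v
      _ ≤ _ := hkey
      _ ≤ _ := by gcongr; exact hqup w
  refine le_of_sq_le_sq ?_ (norm_nonneg _)
  rw [mul_pow, mul_pow, Real.sq_sqrt hc0.le, ← Real.exp_nat_mul]
  have hexp : Real.exp (-4 * κ * B) * Real.exp (2 * κ * B) = Real.exp (-2 * κ * B) := by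
    rw [← Real.exp_add]; ring_nf
  have hexp' : ((2 : ℕ) : ℝ) * (-L * t) = -2 * L * t := by push_cast; ring
  rw [hexp']
  refine le_of_mul_le_mul_right ?_ (show 0 < (r / σ + 1) * Real.exp (2 * κ * B) by positivity)
  have hcancel : min (r / σ) 1 / (r / σ + 1) * (r / σ + 1) = min (r / σ) 1 := by field_simp
  calc _ = min (r / σ) 1 / (r / σ + 1) * (r / σ + 1) * ‖v‖ ^ 2 *
        (Real.exp (-4 * κ * B) * Real.exp (2 * κ * B)) * Real.exp (-2 * L * t) := by ring
    _ ≤ (r / σ + 1) * ‖w‖ ^ 2 * Real.exp (2 * κ * B) := by rw [hcancel, hexp]; exact hle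
    _ = _ := by ring

theorem generalizedLorenz_zero (σ r b A : ℝ) : generalizedLorenz σ r b A 0 = 0 := by
  ext i
  fin_cases i <;> simp [generalizedLorenz]

theorem exists_stable_eigenvector (hσ : 0 < σ) (hr : 0 < r) :
    ∃ v : EuclideanSpace ℝ (Fin 3), v ≠ 0 ∧ fderiv ℝ (generalizedLorenz σ r b A) 0 v =
      (-((σ + 1 + √((σ - 1) ^ 2 + 4 * σ * r)) / 2)) • v := by
  have hS : √((σ - 1) ^ 2 + 4 * σ * r) ^ 2 = (σ - 1) ^ 2 + 4 * σ * r :=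
    Real.sq_sqrt (by positivity)
  -- The row -σv₀ + σv₁ = -Lv₀ with v₀ = σ forces v₁ = σ - L; the second row is then the
  -- characteristic equation of L.
  refine ⟨!₂[σ, σ - (σ + 1 + √((σ - 1) ^ 2 + 4 * σ * r)) / 2, 0], fun h => hσ.ne' ?_, ?_⟩
  · simpa using congrArg (fun w : EuclideanSpace ℝ (Fin 3) => w 0) h
  · rw [fderiv_generalizedLorenz_apply]
    ext i
    fin_cases i
    · simp; ring
    · simp; linear_combination -hS / 4
    · simp

theorem lyapunovDim_generalizedLorenz (hσ : 0 < σ) (hr : 0 < r) (hb : 0 < b) (hA : 0 < A)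
    (hparam : (σ = A * r ∧ b < 1) ∨ (σ = A * r ∧ 1 ≤ b ∧ b < σ) ∨ (A * r ≤ σ ∧ b = 1))
    (hdim : 2 * (σ + b + 1) / (σ + 1 + √((σ - 1) ^ 2 + 4 * σ * r)) ≤ 1)
    {K : Set (EuclideanSpace ℝ (Fin 3))} (hK : IsCompact K)
    (hinv : IsInvariantSet (generalizedLorenz σ r b A) K) (h0 : 0 ∈ K) :
    lyapunovDim (generalizedLorenz σ r b A) K =
      3 - 2 * (σ + b + 1) / (σ + 1 + √((σ - 1) ^ 2 + 4 * σ * r)) := by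
  have h := generatesDynamicalSystem_generalizedLorenz hσ hr hb hA
  have hf := contDiff_generalizedLorenz σ r b A
  obtain ⟨v₀, hv₀, heig⟩ := exists_stable_eigenvector (b := b) (A := A) hσ hr
  obtain ⟨c, hc, hnorm⟩ := fundamentalMatrix_norm_lower_bound hσ hr hb hA hparam h hK hinv
  have hden : 0 < σ + 1 + √((σ - 1) ^ 2 + 4 * σ * r) := by positivity
  rw [div_le_one hden] at hdim
  rw [lyapunovDim_eq_of_bounds (n := 2) (τ := σ + b + 1) (by positivity) (by linarith) hc h0 hv₀
    (fun u _ t ht => ?_) hnorm (fun t ht => ?_)]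
  · push_cast
    field_simp
    ring
  · rw [det_fundamentalMatrix_generalizedLorenz h u ht, Real.abs_exp]
  · rw [fundamentalMatrix_apply_eigenvector hf h (generalizedLorenz_zero σ r b A) heig ht, norm_smul,
      Real.norm_eq_abs,
      Real.abs_exp]

end Lorenz

end LyapunovDimension

end

theorem corollary2 (σ r b A : ℝ) (hσ : 0 < σ) (hr : 0 < r) (hb : 0 < b) (hA : 0 < A)
    (hparam : (σ = A * r ∧ b < 1) ∨ (σ = A * r ∧ 1 ≤ b ∧ b < σ) ∨ (A * r ≤ σ ∧ b = 1))
    (hdim : 2 * (σ + b + 1) / (σ + 1 + √((σ - 1) ^ 2 + 4 * σ * r)) ≤ 1) :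
    LyapunovDimension.GeneratesDynamicalSystem
        (LyapunovDimension.generalizedLorenz σ r b A) ∧
      LyapunovDimension.lyapunovDim (LyapunovDimension.generalizedLorenz σ r b A) {0} =
        3 - 2 * (σ + b + 1) / (σ + 1 + √((σ - 1) ^ 2 + 4 * σ * r)) ∧
      ∀ K : Set (EuclideanSpace ℝ (Fin 3)), IsCompact K →
        LyapunovDimension.IsInvariantSet (LyapunovDimension.generalizedLorenz σ r b A) K →
        0 ∈ K →
        LyapunovDimension.lyapunovDim (LyapunovDimension.generalizedLorenz σ r b A) K =
          3 - 2 * (σ + b + 1) / (σ + 1 + √((σ - 1) ^ 2 + 4 * σ * r)) := by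
  have h := LyapunovDimension.generatesDynamicalSystem_generalizedLorenz hσ hr hb hA
  refine ⟨h, ?_, fun K hK hinv h0 =>
    LyapunovDimension.lyapunovDim_generalizedLorenz hσ hr hb hA hparam hdim hK hinv h0⟩
  exact LyapunovDimension.lyapunovDim_generalizedLorenz hσ hr hb hA hparam hdim isCompact_singleton
    (LyapunovDimension.isInvariantSet_singleton_of_zero h
      (LyapunovDimension.generalizedLorenz_zero σ r b A)) rfl
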